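/- Let $M$ be a smooth manifold of dimension $n$, let $A^k(M)=\Gamma(\wedge^kTM)$ (with $A^0(M)=C^\infty(M)$ and $A^{-1}(M)=0$), let $\mathcal A(M)=\bigoplus_{k\ge 0}A^k(M)$, and let $[\cdot,\cdot]$ denote the Schouten–Nijenhuis bracket of multivector fields. A *higher connection* on $M$ is a map $\nabla:\mathcal A(M)\times\mathcal A(M)\to\mathcal A(M)$, $(X,Y)\mapsto\nabla_XY$, such that 1. $\nabla_XY\in A^{k+l-1}(M)$ for $X\in A^k(M)$, $Y\in A^l(M)$; 2. $\nabla_{fX+X'}Y=f\nabla_XY+\nabla_{X'}Y$ and $\nabla_X(Y+Y')=\nabla_XY+\nabla_XY'$ for $X,X',Y,Y'\in\mathcal A(M)$, $f\in C^\infty(M)$; 3. $\nabla_Xf=[X,f]$ and $\nabla_X(fY)=[X,f]\wedge Y+f\nabla_XY$ for $X\in A^k(M)$, $f\in C^\infty(M)$, $Y\in\mathcal A(M)$; 4. $\nabla_fX=0$ for $f\in C^\infty(M)$, $X\in\mathcal A(M)$. It is *upper induced* if $$\nabla_X(Y\wedge Z)=(\nabla_XY)\wedge Z+(-1)^{(k-1)l}\,Y\wedge\nabla_XZ,$$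 and *lower induced* if $$\nabla_{X\wedge Y}Z=X\wedge\nabla_YZ+(-1)^{kl}\,Y\wedge\nabla_XZ,$$ in each case for all $k,l\ge 0$, $X\in A^k(M)$, $Y\in A^l(M)$, $Z\in\mathcal A(M)$. It is *induced by* an affine connection $D$ on $TM$ if it is both upper and lower induced and $\nabla_XY=D_XY$ for all vector fields $X,Y$. It is *torsion-free* if $$\nabla_XY-(-1)^{(k-1)(l-1)}\nabla_YX-[X,Y]=0\qquad\text{for all }k,l\ge 0,\ X\in A^k(M),\ Y\in A^l(M).$$ A pair $(D,\{F^{k,l}\})$ is *associated* to $\nabla$ if $D$ is an affine connection on $TM$ and the $F^{k,l}$ (the *twist fields*) are smooth sections of $\wedge^{k+l-1}TM\otimes\wedge^kT^*M\otimes\wedge^lT^*M$ for $k,l\ge 1$, with $F^{1,1}=0$ and the convention $F^{k,l}=0$ if $kl=0$, such that $\nabla_XY=\widetilde D_XY+F^{k,l}(X,Y)$ for all $X\in A^k(M)$, $Y\in A^l(M)$, where $\widetilde D$ is the higher connection induced by $D$. **Corollary.** Let $\nabla$ be a torsion-free higher connection on $M$ that is upper induced or lower induced. Then there is an affine connection $D$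 on $TM$, torsion-free in the usual sense ($D_XY-D_YX=[X,Y]$ for all vector fields $X,Y$), such that $\nabla$ is induced by $D$. Moreover, a pair $(D',\{F^{k,l}\})$ is associated to $\nabla$ if and only if $D'=D$ and $F^{k,l}=0$ for all $k,l$; that is, all twist fields of $\nabla$ vanish. -/

import Mathlib

open scoped Manifold ContDiff Bundle

noncomputable section

namespace HigherConn

/-! ### Multivectors and multivector fields on an `n`-dimensional smooth manifold -/

/-- The full exterior algebra `⋀ T_pM` of the tangent space at `p`. -/
abbrev Multivector (n : ℕ) {M : Type*} [TopologicalSpace M]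
    [ChartedSpace (EuclideanSpace ℝ (Fin n)) M] (p : M) : Type :=
  ExteriorAlgebra ℝ (TangentSpace (𝓡 n) p)

/-- A not necessarily smooth section of the bundle `⋀ TM`. -/
abbrev RoughField (n : ℕ) (M : Type*) [TopologicalSpace M]
    [ChartedSpace (EuclideanSpace ℝ (Fin n)) M] : Type _ :=
  ∀ p : M, Multivector n p

section

variable {n : ℕ} {M : Type*} [TopologicalSpace M]
  [ChartedSpace (EuclideanSpace ℝ (Fin n)) M] [IsManifold (𝓡 n) ∞ M]

/-- The value at `q` of the section `P`, read in the trivialization of `⋀ TM` that is induced by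
the preferred chart at `p₀` (meaningful for `q` in the domain of that chart). -/
def localRep (p₀ : M) (P : RoughField n M) (q : M) :
    ExteriorAlgebra ℝ (EuclideanSpace ℝ (Fin n)) :=
  ExteriorAlgebra.map
    ((trivializationAt (EuclideanSpace ℝ (Fin n)) (TangentSpace (𝓡 n) : M → Type) p₀).linearMapAt
      ℝ q) (P q)

/-- The standard basis `e_S`, `S ⊆ {0, …, n-1}`, of the exterior algebra of `ℝⁿ`. -/
def extBasis (n : ℕ) :
    Module.Basis (Finset (Fin n)) ℝ (ExteriorAlgebra ℝ (EuclideanSpace ℝ (Fin n))) :=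
  (EuclideanSpace.basisFun (Fin n) ℝ).toBasis.ExteriorAlgebra

/-- A section of `⋀ TM` is smooth if in each chart all its components are smooth functions. -/
def IsSmooth (P : RoughField n M) : Prop :=
  ∀ (p₀ : M) (S : Finset (Fin n)),
    ContMDiffOn (𝓡 n) 𝓘(ℝ, ℝ) ∞ (fun q => (extBasis n).coord S (localRep p₀ P q))
      (chartAt (EuclideanSpace ℝ (Fin n)) p₀).source

end

/-- `𝒜(M)`: the `ℝ`-algebra, under the wedge product, of smooth sections of `⋀ TM`. -/
def MV (n : ℕ) (M : Type*) [TopologicalSpace M]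
    [ChartedSpace (EuclideanSpace ℝ (Fin n)) M] [IsManifold (𝓡 n) ∞ M] :
    Subalgebra ℝ (RoughField n M) where
  carrier := {P | IsSmooth P}
  mul_mem' := by
    intro P Q hP hQ p₀ S
    have h : (fun q => (extBasis n).coord S (localRep p₀ (P * Q) q)) = fun q =>
        ∑ A, ∑ B, ((extBasis n).coord A (localRep p₀ P q) *
          (extBasis n).coord B (localRep p₀ Q q)) *
          (extBasis n).coord S (extBasis n A * extBasis n B) := by
      funext q
      have e : localRep p₀ (P * Q) q = localRep p₀ P q * localRep p₀ Q q := by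
        simp [localRep]
      rw [e]
      conv_lhs => rw [← (extBasis n).sum_repr (localRep p₀ P q),
        ← (extBasis n).sum_repr (localRep p₀ Q q)]
      rw [Finset.sum_mul_sum]
      simp only [map_sum, smul_mul_smul_comm, map_smul, smul_eq_mul, Module.Basis.coord_apply]
    rw [h]
    exact contMDiffOn_finsetSum fun A _ => contMDiffOn_finsetSum fun B _ =>
      ((hP p₀ A).mul (hQ p₀ B)).mul contMDiffOn_const
  add_mem' := by
    intro P Q hP hQ p₀ S
    have h : (fun q => (extBasis n).coord S (localRep p₀ (P + Q) q)) = fun q =>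
        (extBasis n).coord S (localRep p₀ P q) + (extBasis n).coord S (localRep p₀ Q q) := by
      funext q
      simp [localRep]
    rw [h]
    exact (hP p₀ S).add (hQ p₀ S)
  algebraMap_mem' := by
    intro r p₀ S
    have h : (fun q => (extBasis n).coord S
        (localRep p₀ (algebraMap ℝ (RoughField n M) r) q)) = fun _ =>
        (extBasis n).coord S (algebraMap ℝ _ r) := by
      funext q
      simp [localRep, Pi.algebraMap_apply]
    rw [h]
    exact contMDiffOn_const

/-- Smooth real functions on `M`. -/
abbrev Fun (n : ℕ) (M : Type*) [TopologicalSpace M]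
    [ChartedSpace (EuclideanSpace ℝ (Fin n)) M] : Type _ :=
  C^∞⟮𝓡 n, M; 𝓘(ℝ, ℝ), ℝ⟯

/-- Smooth vector fields on `M`. -/
abbrev VF (n : ℕ) (M : Type*) [TopologicalSpace M]
    [ChartedSpace (EuclideanSpace ℝ (Fin n)) M] [IsManifold (𝓡 n) ∞ M] : Type _ :=
  Cₛ^∞⟮𝓡 n; EuclideanSpace ℝ (Fin n), (TangentSpace (𝓡 n) : M → Type)⟯

section

variable {n : ℕ} {M : Type*} [TopologicalSpace M]
  [ChartedSpace (EuclideanSpace ℝ (Fin n)) M] [IsManifold (𝓡 n) ∞ M]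

/-- A smooth function as a multivector field of degree `0`; the product `f X` of a function and a
multivector field is `ofFun f * X`. -/
def ofFun (f : Fun n M) : MV n M :=
  ⟨fun p => algebraMap ℝ (Multivector n p) (f p), by
    intro p₀ S
    have h : (fun q => (extBasis n).coord S (localRep p₀
        (fun p => algebraMap ℝ (Multivector n p) (f p)) q)) = fun q =>
        f q * (extBasis n).coord S 1 := by
      funext q
      simp only [localRep, AlgHom.commutes]
      rw [Algebra.algebraMap_eq_smul_one, map_smul, smul_eq_mul]
    rw [h]
    exact f.contMDiff.contMDiffOn.mul contMDiffOn_const⟩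

/-- A smooth vector field as a multivector field of degree `1`. -/
def ofVF (X : VF n M) : MV n M :=
  ⟨fun p => ExteriorAlgebra.ι ℝ (X p), by
    intro p₀ S
    have h : (fun q => (extBasis n).coord S (localRep p₀
        (fun p => ExteriorAlgebra.ι ℝ (X p)) q)) = fun q =>
        (((extBasis n).coord S) ∘ₗ (ExteriorAlgebra.ι ℝ)).toContinuousLinearMap
          ((trivializationAt (EuclideanSpace ℝ (Fin n))
            (TangentSpace (𝓡 n) : M → Type) p₀).linearMapAt ℝ q (X q)) := by
      funext q
      simp [localRep]
    rw [h]
    have hX : ContMDiffOn (𝓡 n) 𝓘(ℝ, EuclideanSpace ℝ (Fin n)) ∞ (fun q =>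
        (trivializationAt (EuclideanSpace ℝ (Fin n))
            (TangentSpace (𝓡 n) : M → Type) p₀).linearMapAt ℝ q (X q))
        (chartAt (EuclideanSpace ℝ (Fin n)) p₀).source := by
      have h1 := ((trivializationAt (EuclideanSpace ℝ (Fin n))
        (TangentSpace (𝓡 n) : M → Type) p₀).contMDiffOn_section_baseSet_iff (IB := 𝓡 n)
          (n := ∞) (s := fun q => X q)).1 X.contMDiff.contMDiffOn
      refine h1.congr fun q hq => ?_
      rw [Bundle.Trivialization.coe_linearMapAt_of_mem _ hq]
    exact (ContinuousLinearMap.contMDiff _).comp_contMDiffOn hX⟩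

/-- `X ∈ A^k(M)`: the multivector field `X` is a section of `⋀^k TM`. -/
def IsKVector (k : ℕ) (X : MV n M) : Prop :=
  ∀ p : M, X.1 p ∈ ⋀[ℝ]^k (TangentSpace (𝓡 n) p)

/-! ### The Schouten-Nijenhuis bracket -/

/-- The partial derivative `∂P/∂xⁱ` at `p`, computed componentwise in the preferred chart at `p`. -/
def partialDeriv (i : Fin n) (P : RoughField n M) (p : M) :
    ExteriorAlgebra ℝ (EuclideanSpace ℝ (Fin n)) :=
  ∑ S : Finset (Fin n),
    (fderiv ℝ (fun y => (extBasis n).coord S (localRep p P ((extChartAt (𝓡 n) p).symm y)))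
      (extChartAt (𝓡 n) p p) (EuclideanSpace.single i 1)) • extBasis n S

/-- The coordinate form `dxⁱ` on `ℝⁿ`. -/
def coordForm (n : ℕ) (i : Fin n) : Module.Dual ℝ (EuclideanSpace ℝ (Fin n)) :=
  (EuclideanSpace.basisFun (Fin n) ℝ).toBasis.coord i

/-- The Schouten-Nijenhuis bracket of multivector fields, by the usual coordinate formula
`[P, Q] = ∑ᵢ (P ⌊ dxⁱ) ∧ ∂ᵢQ - ∂ᵢP ∧ (dxⁱ ⌋ Q)`. Here `⌊` and `⌋` are the interior products with a
covector from the right and from the left: `(P ∧ v) ⌊ d = d(v) P - (P ⌊ d) ∧ v` and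
`d ⌋ (v ∧ Q) = d(v) Q - v ∧ (d ⌋ Q)`. The right hand side does not depend on the chart.
For vector fields it is the Lie bracket, `[X, f] = X f` for a vector field `X` and a function `f`,
and `[P, Q ∧ R] = [P, Q] ∧ R + (-1)^((p-1)q) Q ∧ [P, R]` for `P`, `Q` of degrees `p`, `q`. -/
def schouten (P Q : RoughField n M) : RoughField n M := fun p =>
  ExteriorAlgebra.map
    ((trivializationAt (EuclideanSpace ℝ (Fin n)) (TangentSpace (𝓡 n) : M → Type) p).symmₗ ℝ p)
    (∑ i : Fin n,
      (CliffordAlgebra.contractRight (localRep p P p) (coordForm n i) * partialDeriv i Q p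
        - partialDeriv i P p * CliffordAlgebra.contractLeft (coordForm n i) (localRep p Q p)))

/-- The sign `(-1)^a`. -/
def sgn (a : ℤ) : ℝ := (-1 : ℝ) ^ a

end

/-! ### Higher connections and affine connections -/

/-- A higher affine connection on `M`. In `degree` the case `k = l = 0` is left out, where
`A^(-1)(M) = 0` and the condition is contained in `fun_left`. -/
structure HigherConnection (n : ℕ) (M : Type*) [TopologicalSpace M]
    [ChartedSpace (EuclideanSpace ℝ (Fin n)) M] [IsManifold (𝓡 n) ∞ M] where
  /-- `∇ X Y = ∇_X Y` -/
  nabla : MV n M → MV n M → MV n M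
  degree : ∀ (k l : ℕ) (X Y : MV n M), IsKVector k X → IsKVector l Y → 0 < k + l →
    IsKVector (k + l - 1) (nabla X Y)
  linear_left : ∀ (f : Fun n M) (X X' Y : MV n M),
    nabla (ofFun f * X + X') Y = ofFun f * nabla X Y + nabla X' Y
  add_right : ∀ X Y Y' : MV n M, nabla X (Y + Y') = nabla X Y + nabla X Y'
  fun_right : ∀ (k : ℕ) (X : MV n M) (f : Fun n M), IsKVector k X →
    (nabla X (ofFun f) : RoughField n M) = schouten X (ofFun f)
  leibniz : ∀ (k : ℕ) (X : MV n M) (f : Fun n M) (Y : MV n M), IsKVector k X →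
    (nabla X (ofFun f * Y) : RoughField n M) =
      schouten X (ofFun f) * (Y : RoughField n M) + ((ofFun f * nabla X Y : MV n M) : RoughField n M)
  fun_left : ∀ (f : Fun n M) (X : MV n M), nabla (ofFun f) X = 0

/-- An affine connection on `TM`, as an operator on smooth vector fields. -/
structure AffineConnection (n : ℕ) (M : Type*) [TopologicalSpace M]
    [ChartedSpace (EuclideanSpace ℝ (Fin n)) M] [IsManifold (𝓡 n) ∞ M] where
  /-- `D X Y = D_X Y` -/
  nabla : VF n M → VF n M → VF n M
  add_left : ∀ X X' Y : VF n M, nabla (X + X') Y = nabla X Y + nabla X' Y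
  smul_left : ∀ (f : Fun n M) (X fX Y : VF n M), (∀ p, fX p = f p • X p) →
    ∀ p, nabla fX Y p = f p • nabla X Y p
  add_right : ∀ X Y Y' : VF n M, nabla X (Y + Y') = nabla X Y + nabla X Y'
  leibniz : ∀ (f : Fun n M) (X Y fY : VF n M), (∀ p, fY p = f p • Y p) →
    ∀ p, nabla X fY p =
      (show ℝ from mfderiv (𝓡 n) 𝓘(ℝ, ℝ) f p (X p)) • Y p + f p • nabla X Y p

section

variable {n : ℕ} {M : Type*} [TopologicalSpace M]
  [ChartedSpace (EuclideanSpace ℝ (Fin n)) M] [IsManifold (𝓡 n) ∞ M]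

/-- Vanishing of the usual torsion `D_X Y - D_Y X - [X, Y]`. -/
def AffineConnection.IsTorsionFree (D : AffineConnection n M) : Prop :=
  ∀ (X Y : VF n M) (p : M),
    D.nabla X Y p - D.nabla Y X p - VectorField.mlieBracket (𝓡 n) X Y p = 0

namespace HigherConnection

/-- The higher torsion `T(X, Y)` for `X ∈ A^k(M)` and `Y ∈ A^l(M)`. -/
def torsion (C : HigherConnection n M) (k l : ℕ) (X Y : MV n M) : RoughField n M :=
  (C.nabla X Y : RoughField n M)
    - sgn (((k : ℤ) - 1) * ((l : ℤ) - 1)) • (C.nabla Y X : RoughField n M) - schouten X Y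

def IsTorsionFree (C : HigherConnection n M) : Prop :=
  ∀ (k l : ℕ) (X Y : MV n M), IsKVector k X → IsKVector l Y → C.torsion k l X Y = 0

def IsUpperInduced (C : HigherConnection n M) : Prop :=
  ∀ (k l : ℕ) (X Y Z : MV n M), IsKVector k X → IsKVector l Y →
    C.nabla X (Y * Z) =
      C.nabla X Y * Z + sgn (((k : ℤ) - 1) * (l : ℤ)) • (Y * C.nabla X Z)

def IsLowerInduced (C : HigherConnection n M) : Prop :=
  ∀ (k l : ℕ) (X Y Z : MV n M), IsKVector k X → IsKVector l Y →
    C.nabla (X * Y) Z =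
      X * C.nabla Y Z + sgn ((k : ℤ) * (l : ℤ)) • (Y * C.nabla X Z)

/-- `C` is the higher connection induced by the affine connection `D`: it is induced, i.e. satisfies
both product rules, and it restricts to `D` on vector fields. -/
def IsInducedBy (C : HigherConnection n M) (D : AffineConnection n M) : Prop :=
  C.IsLowerInduced ∧ C.IsUpperInduced ∧
    ∀ X Y : VF n M, C.nabla (ofVF X) (ofVF Y) = ofVF (D.nabla X Y)

end HigherConnection

end

/-- A collection of smooth sections `F^{k,l}` of `⋀^{k+l-1} TM ⊗ ⋀^k T*M ⊗ ⋀^l T*M`, i.e. of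
bilinear maps `⋀^k T_pM × ⋀^l T_pM → ⋀^{k+l-1} T_pM` depending smoothly on `p`, with `F^{1,1} = 0`,
and with the convention `F^{k,l} = 0` if `k = 0` or `l = 0`. (If `k + l - 1 > n`, then
`⋀^{k+l-1} T_pM = 0`.) -/
structure TwistData (n : ℕ) (M : Type*) [TopologicalSpace M]
    [ChartedSpace (EuclideanSpace ℝ (Fin n)) M] [IsManifold (𝓡 n) ∞ M] where
  twist : ∀ (k l : ℕ) (p : M), ⋀[ℝ]^k (TangentSpace (𝓡 n) p) →ₗ[ℝ]
    ⋀[ℝ]^l (TangentSpace (𝓡 n) p) →ₗ[ℝ] ⋀[ℝ]^(k + l - 1) (TangentSpace (𝓡 n) p)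
  smooth : ∀ (k l : ℕ) (X Y : MV n M) (hX : IsKVector k X) (hY : IsKVector l Y),
    IsSmooth (fun p : M =>
      (twist k l p ⟨X.1 p, hX p⟩ ⟨Y.1 p, hY p⟩ : Multivector n p))
  one_one : ∀ p : M, twist 1 1 p = 0
  zero_left : ∀ (l : ℕ) (p : M), twist 0 l p = 0
  zero_right : ∀ (k : ℕ) (p : M), twist k 0 p = 0

/-- The pair `(D, F)` of an affine connection and twist fields is associated to the higher
connection `C`: `C_X Y = D_X Y + F^{k,l}(X, Y)` for `X ∈ A^k(M)` and `Y ∈ A^l(M)`, where `D_X Y`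
is formed with the higher connection induced by `D`. -/
def HigherConnection.IsAssociated {n : ℕ} {M : Type*} [TopologicalSpace M]
    [ChartedSpace (EuclideanSpace ℝ (Fin n)) M] [IsManifold (𝓡 n) ∞ M]
    (C : HigherConnection n M) (D : AffineConnection n M) (F : TwistData n M) : Prop :=
  ∃ C' : HigherConnection n M, C'.IsInducedBy D ∧
    ∀ (k l : ℕ) (X Y : MV n M) (hX : IsKVector k X) (hY : IsKVector l Y) (p : M),
      (C.nabla X Y).1 p =
        (C'.nabla X Y).1 p + (F.twist k l p ⟨X.1 p, hX p⟩ ⟨Y.1 p, hY p⟩ : Multivector n p)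

end HigherConn

end

/-!
If `∇` is torsion-free, then `∇_W Z` is `[W, Z]` plus or minus `∇_Z W`, and `[·, Z]` itself
satisfies the lower product rule. Hence the failure of the lower rule at `(X, Y, Z)` is, up to a
sign, the failure of the upper rule at `(Z, X, Y)`: each of the two rules implies the other, and
`∇` is induced by its restriction `D` to vector fields, which is torsion-free because the
Schouten-Nijenhuis bracket of vector fields is the Lie bracket. If `(D', F)` is associated to `∇`,
then `F^{1,1} = 0` gives `D' = D`. Two higher connections induced by `D` agree on wedge products of
vector fields, so all `F^{k,l}` vanish on these, and at each point the values of these products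
span `⋀ T_pM`.
-/

noncomputable section

namespace HigherConn

section ExteriorAlgebra

open CliffordAlgebra (contractLeft contractRight)
open ExteriorAlgebra (ι)

variable {R V W : Type*} [CommRing R] [AddCommGroup V] [Module R V] [AddCommGroup W] [Module R W]

theorem ι_mul_comm_of_mem_exteriorPower (v : V) {l : ℕ} {y : ExteriorAlgebra R V}
    (hy : y ∈ ⋀[R]^l V) :
    ι R v * y = (-1 : R) ^ l • (y * ι R v) := by
  induction hy using Submodule.pow_induction_on_left' with
  | algebraMap r => rw [pow_zero, one_smul, Algebra.commutes]
  | add y z i _ _ ihy ihz => rw [mul_add, ihy, ihz, add_mul, smul_add]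
  | mem_mul w hw i y _ ih =>
    obtain ⟨w, rfl⟩ := hw
    have anticomm : ι R v * ι R w = -(ι R w * ι R v) :=
      eq_neg_of_add_eq_zero_left (ExteriorAlgebra.ι_add_mul_swap v w)
    rw [← mul_assoc, anticomm, neg_mul, mul_assoc, ih, mul_smul_comm, mul_assoc, pow_succ,
      mul_neg_one, neg_smul]

theorem mul_comm_of_mem_exteriorPower {k l : ℕ} {x y : ExteriorAlgebra R V} (hx : x ∈ ⋀[R]^k V)
    (hy : y ∈ ⋀[R]^l V) : x * y = (-1 : R) ^ (k * l) • (y * x) := by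
  induction hx using Submodule.pow_induction_on_left' with
  | algebraMap r => rw [zero_mul, pow_zero, one_smul, Algebra.commutes]
  | add x z i _ _ ihx ihz => rw [add_mul, ihx, ihz, mul_add, smul_add]
  | mem_mul v hv i x _ ih =>
    obtain ⟨v, rfl⟩ := hv
    rw [mul_assoc, ih, mul_smul_comm, ← mul_assoc,
      ι_mul_comm_of_mem_exteriorPower v hy, smul_mul_assoc, smul_smul, mul_assoc, ← pow_add,
      Nat.succ_mul]

theorem contractRight_mul (d : Module.Dual R V) (x : ExteriorAlgebra R V) {l : ℕ}
    {y : ExteriorAlgebra R V} (hy : y ∈ ⋀[R]^l V) :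
    contractRight (x * y) d = x * contractRight y d + (-1 : R) ^ l • (contractRight x d * y) := by
  induction hy using Submodule.pow_induction_on_right' with
  | algebraMap r =>
    simp only [CliffordAlgebra.contractRight_mul_algebraMap,
      CliffordAlgebra.contractRight_algebraMap, mul_zero, zero_add, pow_zero, one_smul]
  | add y z i _ _ ihy ihz =>
    simp only [mul_add, map_add, LinearMap.add_apply, ihy, ihz, smul_add]
    abel
  | mul_mem i y _ ih v hv =>
    obtain ⟨v, rfl⟩ := hv
    rw [← mul_assoc, CliffordAlgebra.contractRight_mul_ι, CliffordAlgebra.contractRight_mul_ι, ih]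
    simp only [mul_sub, add_mul, pow_succ, mul_neg_one, neg_smul, mul_smul_comm, smul_mul_assoc,
      mul_assoc]
    abel

theorem ι_mem_exteriorPower_one (v : V) : ι R v ∈ ⋀[R]^1 V := by
  rw [ExteriorAlgebra.exteriorPower, pow_one]
  exact LinearMap.mem_range_self _ v

/- As `d ⌋ z` has degree `m - 1`, the sign is that of `l * (m - 1)`; it is written so that it makes
sense for `m = 0` too. -/
theorem mul_contractLeft_comm_of_mem_exteriorPower (d : Module.Dual R V) {l m : ℕ}
    {y z : ExteriorAlgebra R V} (hy : y ∈ ⋀[R]^l V) (hz : z ∈ ⋀[R]^m V) :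
    y * contractLeft d z = (-1 : R) ^ (l * m + l) • (contractLeft d z * y) := by
  induction hz using Submodule.pow_induction_on_left' with
  | algebraMap r =>
    simp only [CliffordAlgebra.contractLeft_algebraMap, mul_zero, zero_mul, smul_zero]
  | add z w i _ _ ihz ihw => rw [map_add, mul_add, ihz, ihw, add_mul, smul_add]
  | mem_mul v hv i z hz ih =>
    obtain ⟨v, rfl⟩ := hv
    have sign : (-1 : R) ^ (l * (i + 1) + l) = (-1) ^ (l * i) := by
      rw [Nat.mul_succ, add_assoc, pow_add, Even.neg_one_pow ⟨l, rfl⟩, mul_one]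
    have sign' : (-1 : R) ^ (l * 1) * (-1) ^ (l * i + l) = (-1) ^ (l * i) := by
      rw [← pow_add, ← sign]
      ring_nf
    rw [CliffordAlgebra.contractLeft_ι_mul, mul_sub, sub_mul, mul_smul_comm, smul_mul_assoc,
      mul_comm_of_mem_exteriorPower hy hz, ← mul_assoc y,
      mul_comm_of_mem_exteriorPower hy (ι_mem_exteriorPower_one v),
      smul_mul_assoc, mul_assoc _ y, ih, mul_smul_comm, smul_smul _ _ (ι R v * _), sign',
      Nat.succ_eq_add_one, sign, smul_sub, smul_comm (d v), mul_assoc]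

theorem contractRight_mul_sub_mul_contractLeft (d : Module.Dual R V) {l m : ℕ}
    (x x' : ExteriorAlgebra R V) {y y' z z' : ExteriorAlgebra R V} (hy : y ∈ ⋀[R]^l V)
    (hz : z ∈ ⋀[R]^m V) (hz' : z' ∈ ⋀[R]^m V) :
    contractRight (x * y) d * z' - (x' * y + x * y') * contractLeft d z =
      x * (contractRight y d * z' - y' * contractLeft d z) +
      (-1 : R) ^ (l * m + l) • ((contractRight x d * z' - x' * contractLeft d z) * y) := by
  have hright : (-1 : R) ^ l • (contractRight x d * y * z') =
      (-1 : R) ^ (l * m + l) • (contractRight x d * z' * y) := by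
    rw [mul_assoc, mul_comm_of_mem_exteriorPower hy hz', mul_smul_comm, smul_smul, ← pow_add,
      mul_assoc, add_comm l]
  have hleft : x' * y * contractLeft d z =
      (-1 : R) ^ (l * m + l) • (x' * contractLeft d z * y) := by
    rw [mul_assoc, mul_contractLeft_comm_of_mem_exteriorPower d hy hz, mul_smul_comm, mul_assoc]
  rw [contractRight_mul d x hy, add_mul, smul_mul_assoc, hright, add_mul, hleft, sub_mul, smul_sub,
    mul_sub x, mul_assoc x, mul_assoc x]
  abel

theorem map_mem_exteriorPower (f : V →ₗ[R] W) {k : ℕ} {x : ExteriorAlgebra R V}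
    (hx : x ∈ ⋀[R]^k V) : ExteriorAlgebra.map f x ∈ ⋀[R]^k W := by
  have hle : (⋀[R]^k V).map (ExteriorAlgebra.map f).toLinearMap ≤ ⋀[R]^k W := by
    rw [Submodule.map_pow]
    refine pow_le_pow_left' ?_ k
    rintro _ ⟨_, ⟨v, rfl⟩, rfl⟩
    exact ⟨f v, (ExteriorAlgebra.map_apply_ι f v).symm⟩
  exact hle ⟨x, hx, rfl⟩

/-- The projection of the exterior algebra onto its part of degree `k`. -/
def degreeProj (R V : Type*) [CommRing R] [AddCommGroup V] [Module R V] (k : ℕ) :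
    ExteriorAlgebra R V →ₗ[R] ExteriorAlgebra R V :=
  GradedAlgebra.proj (fun i : ℕ => ⋀[R]^i V) k

theorem degreeProj_mem (k : ℕ) (x : ExteriorAlgebra R V) : degreeProj R V k x ∈ ⋀[R]^k V := by
  rw [degreeProj, GradedAlgebra.proj_apply]
  exact SetLike.coe_mem _

theorem degreeProj_of_mem {k : ℕ} {x : ExteriorAlgebra R V} (hx : x ∈ ⋀[R]^k V) (j : ℕ) :
    degreeProj R V j x = if k = j then x else 0 := by
  rw [degreeProj, GradedAlgebra.proj_apply, DirectSum.decompose_of_mem (fun i : ℕ => ⋀[R]^i V) hx,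
    DirectSum.coe_of_apply]
  split <;> rfl

theorem map_degreeProj (f : V →ₗ[R] W) (k : ℕ) (x : ExteriorAlgebra R V) :
    ExteriorAlgebra.map f (degreeProj R V k x) =
      degreeProj R W k (ExteriorAlgebra.map f x) := by
  induction x using DirectSum.Decomposition.inductionOn (fun i : ℕ => ⋀[R]^i V) with
  | zero => simp only [map_zero]
  | homogeneous x =>
    rw [degreeProj_of_mem x.2, degreeProj_of_mem (map_mem_exteriorPower f x.2)]
    split <;> simp only [map_zero]
  | add x y hx hy => simp only [map_add, hx, hy]

variable {I : Type*} [LinearOrder I]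

theorem basis_mem_exteriorPower (b : Module.Basis I R V) (S : Finset I) :
    b.ExteriorAlgebra S ∈ ⋀[R]^S.card V := by
  rw [ExteriorAlgebra.basis_apply_ofCard b rfl]
  exact ExteriorAlgebra.ιMulti_range R S.card ⟨_, rfl⟩

theorem degreeProj_basis (b : Module.Basis I R V) (S : Finset I) (k : ℕ) :
    degreeProj R V k (b.ExteriorAlgebra S) = if S.card = k then b.ExteriorAlgebra S else 0 :=
  degreeProj_of_mem (basis_mem_exteriorPower b S) k

theorem basis_coord_eq_zero_of_mem (b : Module.Basis I R V) {k : ℕ} {x : ExteriorAlgebra R V}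
    (hx : x ∈ ⋀[R]^k V) {S : Finset I} (hS : S.card ≠ k) : b.ExteriorAlgebra.coord S x = 0 := by
  have hcomp : b.ExteriorAlgebra.coord S ∘ₗ degreeProj R V k = 0 := by
    refine b.ExteriorAlgebra.ext fun T => ?_
    rw [LinearMap.comp_apply, degreeProj_basis b]
    split_ifs with hT
    · have hTS : T ≠ S := fun h => hS (h ▸ hT)
      rw [Module.Basis.coord_apply, Module.Basis.repr_self, Finsupp.single_eq_of_ne' hTS,
        LinearMap.zero_apply]
    · rw [map_zero, LinearMap.zero_apply]
  have hx' := LinearMap.congr_fun hcomp x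
  rwa [LinearMap.comp_apply, degreeProj_of_mem hx, if_pos rfl] at hx'

theorem sum_degreeProj [Fintype I] (b : Module.Basis I R V) (x : ExteriorAlgebra R V) :
    ∑ k ∈ Finset.range (Fintype.card I + 1), degreeProj R V k x = x := by
  have hid : ∑ k ∈ Finset.range (Fintype.card I + 1), degreeProj R V k = LinearMap.id := by
    refine b.ExteriorAlgebra.ext fun S => ?_
    have hS : S.card ∈ Finset.range (Fintype.card I + 1) :=
      Finset.mem_range.2 (Nat.lt_succ_of_le S.card_le_univ)
    simp only [LinearMap.sum_apply, degreeProj_basis b, Finset.sum_ite_eq, if_pos hS,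
      LinearMap.id_apply]
  simpa only [LinearMap.sum_apply, LinearMap.id_apply] using LinearMap.congr_fun hid x

end ExteriorAlgebra

section LocalRepresentatives

variable {n : ℕ} {M : Type*} [TopologicalSpace M] [ChartedSpace (EuclideanSpace ℝ (Fin n)) M]

theorem differentiableAt_comp_extChartAt_symm {G : Type*} [NormedAddCommGroup G] [NormedSpace ℝ G]
    {g : M → G} {p : M} (hg : MDifferentiableAt (𝓡 n) 𝓘(ℝ, G) g p) :
    DifferentiableAt ℝ (fun y => g ((extChartAt (𝓡 n) p).symm y)) (extChartAt (𝓡 n) p p) := by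
  have h := ((mdifferentiableAt_iff g p).1 hg).2
  simp only [Function.comp_def, mfld_simps, differentiableWithinAt_univ] at h ⊢
  exact h

variable [IsManifold (𝓡 n) ∞ M]

/-- The coordinates, in the preferred chart at `p₀`, of the tangent vectors at `q`; they are `0`
if `q` is not in the domain of that chart. -/
abbrev tangentCoords (p₀ q : M) : TangentSpace (𝓡 n) q →ₗ[ℝ] EuclideanSpace ℝ (Fin n) :=
  (trivializationAt (EuclideanSpace ℝ (Fin n)) (TangentSpace (𝓡 n) : M → Type) p₀).linearMapAt ℝ q

theorem tangentCoords_self (p : M) (v : TangentSpace (𝓡 n) p) : tangentCoords p p v = v :=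
  (DFunLike.congr_fun (TangentBundle.continuousLinearMapAt_trivializationAt_eq_core (I := 𝓡 n)
    (mem_chart_source (EuclideanSpace ℝ (Fin n)) p)) v).trans
      (tangentCoordChange_self (mem_extChartAt_source (I := 𝓡 n) p))

theorem contMDiffOn_section_iff_tangentCoords (p₀ : M) (s : ∀ q : M, TangentSpace (𝓡 n) q) :
    ContMDiffOn (𝓡 n) ((𝓡 n).prod 𝓘(ℝ, EuclideanSpace ℝ (Fin n))) ∞
        (fun q => Bundle.TotalSpace.mk' (EuclideanSpace ℝ (Fin n)) q (s q))
        (chartAt (EuclideanSpace ℝ (Fin n)) p₀).source ↔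
      ContMDiffOn (𝓡 n) 𝓘(ℝ, EuclideanSpace ℝ (Fin n)) ∞ (fun q => tangentCoords p₀ q (s q))
        (chartAt (EuclideanSpace ℝ (Fin n)) p₀).source := by
  refine ((trivializationAt (EuclideanSpace ℝ (Fin n))
    (TangentSpace (𝓡 n) : M → Type) p₀).contMDiffOn_section_baseSet_iff).trans
      (contMDiffOn_congr fun q hq => ?_)
  rw [Bundle.Trivialization.coe_linearMapAt_of_mem _ hq]

theorem localRep_self (p : M) (P : RoughField n M) : localRep p P p = P p := by
  have hid : tangentCoords (n := n) p p = LinearMap.id := LinearMap.ext (tangentCoords_self p)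
  exact (congrArg (fun L => ExteriorAlgebra.map L (P p)) hid).trans
    (DFunLike.congr_fun (ExteriorAlgebra.map_id (R := ℝ)) (P p))

theorem localRep_mul (p₀ q : M) (P Q : RoughField n M) :
    localRep p₀ (P * Q) q = localRep p₀ P q * localRep p₀ Q q :=
  map_mul (ExteriorAlgebra.map (tangentCoords p₀ q)) (P q) (Q q)

theorem localRep_ofFun (p₀ q : M) (f : Fun n M) :
    localRep p₀ (ofFun f : RoughField n M) q = algebraMap ℝ _ (f q) :=
  AlgHom.commutes _ _

theorem localRep_ofVF (p₀ q : M) (X : VF n M) :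
    localRep p₀ (ofVF X : RoughField n M) q = ExteriorAlgebra.ι ℝ (tangentCoords p₀ q (X q)) :=
  ExteriorAlgebra.map_apply_ι _ _

theorem localRep_mem_exteriorPower {k : ℕ} {X : MV n M} (hX : IsKVector k X) (p₀ q : M) :
    localRep p₀ (X : RoughField n M) q ∈ ⋀[ℝ]^k (EuclideanSpace ℝ (Fin n)) :=
  map_mem_exteriorPower _ (hX q)

variable {G : Type*} [NormedAddCommGroup G] [NormedSpace ℝ G]

theorem contMDiffOn_linearMap_localRep (P : MV n M) (p₀ : M)
    (T : ExteriorAlgebra ℝ (EuclideanSpace ℝ (Fin n)) →ₗ[ℝ] G) :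
    ContMDiffOn (𝓡 n) 𝓘(ℝ, G) ∞ (fun q => T (localRep p₀ (P : RoughField n M) q))
      (chartAt (EuclideanSpace ℝ (Fin n)) p₀).source := by
  have hsum : ContMDiffOn (𝓡 n) 𝓘(ℝ, G) ∞ (fun q => ∑ S,
      (extBasis n).coord S (localRep p₀ (P : RoughField n M) q) • T (extBasis n S))
      (chartAt (EuclideanSpace ℝ (Fin n)) p₀).source :=
    contMDiffOn_finsetSum fun S _ => (P.2 p₀ S).smul contMDiffOn_const
  refine hsum.congr fun q _ => ?_
  conv_lhs => rw [← (extBasis n).sum_repr (localRep p₀ (P : RoughField n M) q)]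
  simp only [map_sum, map_smul, Module.Basis.coord_apply]

theorem coord_partialDeriv (i : Fin n) (P : RoughField n M) (p : M) (S : Finset (Fin n)) :
    (extBasis n).coord S (partialDeriv i P p) =
      fderiv ℝ (fun y => (extBasis n).coord S (localRep p P ((extChartAt (𝓡 n) p).symm y)))
        (extChartAt (𝓡 n) p p) (EuclideanSpace.single i 1) := by
  rw [partialDeriv, Module.Basis.coord_apply, Module.Basis.repr_sum_self]

theorem partialDeriv_eq_of_localRep_eq [FiniteDimensional ℝ G] (i : Fin n) {P : RoughField n M}
    {p : M} (L : G →ₗ[ℝ] ExteriorAlgebra ℝ (EuclideanSpace ℝ (Fin n)))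
    {g : EuclideanSpace ℝ (Fin n) → G} (hg : DifferentiableAt ℝ g (extChartAt (𝓡 n) p p))
    (hP : ∀ y, localRep p P ((extChartAt (𝓡 n) p).symm y) = L (g y)) :
    partialDeriv i P p =
      L (fderiv ℝ g (extChartAt (𝓡 n) p p) (EuclideanSpace.single i 1)) := by
  refine (extBasis n).ext_elem fun S => ?_
  simp only [← Module.Basis.coord_apply, coord_partialDeriv, hP]
  exact DFunLike.congr_fun (((((extBasis n).coord S ∘ₗ L).toContinuousLinearMap).hasFDerivAt.comp _
    hg.hasFDerivAt).fderiv) _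

theorem partialDeriv_mem_exteriorPower {k : ℕ} {X : MV n M} (hX : IsKVector k X) (i : Fin n)
    (p : M) :
    partialDeriv i (X : RoughField n M) p ∈ ⋀[ℝ]^k (EuclideanSpace ℝ (Fin n)) := by
  refine Submodule.sum_mem _ fun S _ => ?_
  by_cases hS : S.card = k
  · exact Submodule.smul_mem _ _ (hS ▸ basis_mem_exteriorPower _ S)
  · have hzero : ∀ q, (extBasis n).coord S (localRep p (X : RoughField n M) q) = 0 :=
      fun q => basis_coord_eq_zero_of_mem _ (localRep_mem_exteriorPower hX p q) hS
    simp only [hzero, fderiv_fun_const, Pi.zero_apply, zero_apply, zero_smul, zero_mem]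

theorem partialDeriv_mul (i : Fin n) (P Q : MV n M) (p : M) :
    partialDeriv i ((P : RoughField n M) * (Q : RoughField n M)) p =
      partialDeriv i (P : RoughField n M) p * localRep p (Q : RoughField n M) p +
      localRep p (P : RoughField n M) p * partialDeriv i (Q : RoughField n M) p := by
  let e := (extBasis n).equivFun
  let coords (R : MV n M) (y : EuclideanSpace ℝ (Fin n)) : Finset (Fin n) → ℝ :=
    e (localRep p (R : RoughField n M) ((extChartAt (𝓡 n) p).symm y))
  have hcoords (R : MV n M) : DifferentiableAt ℝ (coords R) (extChartAt (𝓡 n) p p) :=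
    differentiableAt_comp_extChartAt_symm (((contMDiffOn_linearMap_localRep R p
      e.toLinearMap).contMDiffAt (chart_source_mem_nhds _ p)).mdifferentiableAt (by simp))
  have hderiv (R : MV n M) : partialDeriv i (R : RoughField n M) p =
      e.symm (fderiv ℝ (coords R) (extChartAt (𝓡 n) p p) (EuclideanSpace.single i 1)) :=
    partialDeriv_eq_of_localRep_eq i e.symm.toLinearMap (hcoords R) fun y =>
      (e.symm_apply_apply _).symm
  let mulCoords := (((LinearMap.mul ℝ _).compl₁₂ e.symm.toLinearMap e.symm.toLinearMap).compr₂
    e.toLinearMap).toContinuousBilinearMap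
  have hmul := mulCoords.hasFDerivAt_of_bilinear (hcoords P).hasFDerivAt (hcoords Q).hasFDerivAt
  rw [hderiv P, hderiv Q, partialDeriv_eq_of_localRep_eq i e.symm.toLinearMap
    hmul.differentiableAt fun y => ?_, hmul.fderiv]
  · simpa [mulCoords, coords] using add_comm _ _
  · simp [mulCoords, coords, localRep_mul]

end LocalRepresentatives

theorem sgn_natCast (k : ℕ) : sgn k = (-1) ^ k :=
  zpow_natCast _ k

theorem sgn_add (a b : ℤ) : sgn (a + b) = sgn a * sgn b :=
  zpow_add₀ (by norm_num) a b

theorem sgn_eq_of_even_sub {a b : ℤ} (h : Even (a - b)) : sgn a = sgn b := by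
  rw [← sub_add_cancel a b, sgn_add, sgn, h.neg_one_zpow, one_mul]

section Schouten

variable {n : ℕ}

theorem sum_coordForm_smul {G : Type*} [AddCommGroup G] [Module ℝ G]
    (L : EuclideanSpace ℝ (Fin n) →ₗ[ℝ] G) (v : EuclideanSpace ℝ (Fin n)) :
    ∑ i, coordForm n i v • L (EuclideanSpace.single i 1) = L v := by
  conv_rhs => rw [← (EuclideanSpace.basisFun (Fin n) ℝ).toBasis.sum_repr v]
  simp [coordForm]

variable {M : Type*} [TopologicalSpace M] [ChartedSpace (EuclideanSpace ℝ (Fin n)) M]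

theorem mfderiv_eq_fderiv_comp_extChartAt_symm (f : Fun n M) (p : M) :
    mfderiv (𝓡 n) 𝓘(ℝ, ℝ) f p =
      fderiv ℝ (fun y => f ((extChartAt (𝓡 n) p).symm y)) (extChartAt (𝓡 n) p p) := by
  rw [(f.contMDiff.mdifferentiableAt (by simp)).mfderiv]
  simp only [writtenInExtChartAt, mfld_simps, fderivWithin_univ]
  rfl

variable [IsManifold (𝓡 n) ∞ M]

/-- The value at `p` of the Schouten-Nijenhuis bracket, in the coordinates of the preferred chart
at `p`. -/
def schoutenRep (p : M) (P Q : RoughField n M) : ExteriorAlgebra ℝ (EuclideanSpace ℝ (Fin n)) :=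
  ∑ i : Fin n,
    (CliffordAlgebra.contractRight (localRep p P p) (coordForm n i) * partialDeriv i Q p
      - partialDeriv i P p * CliffordAlgebra.contractLeft (coordForm n i) (localRep p Q p))

theorem schouten_apply (P Q : RoughField n M) (p : M) : schouten P Q p = schoutenRep p P Q := by
  have hid : (trivializationAt (EuclideanSpace ℝ (Fin n)) (TangentSpace (𝓡 n) : M → Type) p).symmₗ
      ℝ p = LinearMap.id (M := EuclideanSpace ℝ (Fin n)) := by
    refine LinearMap.ext fun v => ?_
    refine (congrArg _ (tangentCoords_self p v).symm).trans ?_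
    exact Bundle.Trivialization.symmₗ_linearMapAt (R := ℝ) (trivializationAt
      (EuclideanSpace ℝ (Fin n)) (TangentSpace (𝓡 n) : M → Type) p)
      (FiberBundle.mem_baseSet_trivializationAt' p) v
  exact (congrArg (fun L => ExteriorAlgebra.map L _) hid).trans
    (DFunLike.congr_fun (ExteriorAlgebra.map_id (R := ℝ)) _)

theorem schoutenRep_mul_left {l m : ℕ} (X : MV n M) {Y Z : MV n M} (hY : IsKVector l Y)
    (hZ : IsKVector m Z) (p : M) :
    schoutenRep p ((X : RoughField n M) * (Y : RoughField n M)) (Z : RoughField n M) =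
      localRep p (X : RoughField n M) p * schoutenRep p (Y : RoughField n M) (Z : RoughField n M) +
      sgn (l * (m - 1)) •
        (schoutenRep p (X : RoughField n M) (Z : RoughField n M) *
          localRep p (Y : RoughField n M) p) := by
  have hsgn : sgn (l * (m - 1)) = (-1) ^ (l * m + l) := by
    rw [← sgn_natCast]
    exact sgn_eq_of_even_sub ⟨-l, by push_cast; ring⟩
  simp only [schoutenRep, hsgn, Finset.mul_sum, Finset.sum_mul, Finset.smul_sum,
    ← Finset.sum_add_distrib]
  refine Finset.sum_congr rfl fun i _ => ?_
  rw [localRep_mul, partialDeriv_mul]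
  exact contractRight_mul_sub_mul_contractLeft _ _ _ (localRep_mem_exteriorPower hY p p)
    (localRep_mem_exteriorPower hZ p p) (partialDeriv_mem_exteriorPower hZ i p)

theorem schouten_mul_left {l m : ℕ} (X : MV n M) {Y Z : MV n M} (hY : IsKVector l Y)
    (hZ : IsKVector m Z) :
    schouten ((X : RoughField n M) * (Y : RoughField n M)) (Z : RoughField n M) =
      (X : RoughField n M) * schouten (Y : RoughField n M) (Z : RoughField n M) +
      sgn (l * (m - 1)) •
        (schouten (X : RoughField n M) (Z : RoughField n M) * (Y : RoughField n M)) := by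
  funext p
  rw [Pi.add_apply, Pi.smul_apply, Pi.mul_apply, Pi.mul_apply, schouten_apply, schouten_apply,
    schouten_apply, schoutenRep_mul_left X hY hZ, localRep_self, localRep_self]
  rfl

/-- A vector field in the coordinates of the preferred chart at `p`, as a function on `ℝⁿ`. -/
def chartRep (p : M) (X : VF n M) (y : EuclideanSpace ℝ (Fin n)) : EuclideanSpace ℝ (Fin n) :=
  tangentCoords p ((extChartAt (𝓡 n) p).symm y) (X ((extChartAt (𝓡 n) p).symm y))

theorem differentiableAt_chartRep (p : M) (X : VF n M) :
    DifferentiableAt ℝ (chartRep p X) (extChartAt (𝓡 n) p p) :=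
  differentiableAt_comp_extChartAt_symm ((((contMDiffOn_section_iff_tangentCoords p X).1
    X.contMDiff.contMDiffOn).contMDiffAt (chart_source_mem_nhds _ p)).mdifferentiableAt (by simp))

theorem partialDeriv_ofFun (i : Fin n) (f : Fun n M) (p : M) :
    partialDeriv i (ofFun f : RoughField n M) p = algebraMap ℝ _
      (fderiv ℝ (fun y => f ((extChartAt (𝓡 n) p).symm y)) (extChartAt (𝓡 n) p p)
        (EuclideanSpace.single i 1)) :=
  partialDeriv_eq_of_localRep_eq i (Algebra.linearMap ℝ _)
    (differentiableAt_comp_extChartAt_symm (f.contMDiff.mdifferentiableAt (by simp)))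
    fun _ => localRep_ofFun p _ f

theorem partialDeriv_ofVF (i : Fin n) (X : VF n M) (p : M) :
    partialDeriv i (ofVF X : RoughField n M) p = ExteriorAlgebra.ι ℝ
      (fderiv ℝ (chartRep p X) (extChartAt (𝓡 n) p p) (EuclideanSpace.single i 1)) :=
  partialDeriv_eq_of_localRep_eq i (ExteriorAlgebra.ι ℝ) (differentiableAt_chartRep p X)
    fun _ => localRep_ofVF p _ X

theorem schouten_ofVF_ofFun (X : VF n M) (f : Fun n M) (p : M) :
    schouten (ofVF X : RoughField n M) (ofFun f : RoughField n M) p =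
      algebraMap ℝ _ (show ℝ from mfderiv (𝓡 n) 𝓘(ℝ, ℝ) f p (X p)) := by
  have hsum := sum_coordForm_smul (fderiv ℝ (fun y => f ((extChartAt (𝓡 n) p).symm y))
    (extChartAt (𝓡 n) p p)).toLinearMap (X p)
  have hrep : schoutenRep p (ofVF X : RoughField n M) (ofFun f : RoughField n M) =
      algebraMap ℝ _ (fderiv ℝ (fun y => f ((extChartAt (𝓡 n) p).symm y))
        (extChartAt (𝓡 n) p p) (X p)) := by
    refine Eq.trans ?_ (congrArg _ hsum)
    rw [schoutenRep, map_sum]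
    refine Finset.sum_congr rfl fun i _ => ?_
    rw [localRep_ofVF, tangentCoords_self, localRep_ofFun, partialDeriv_ofFun,
      CliffordAlgebra.contractLeft_algebraMap, mul_zero, sub_zero, smul_eq_mul, map_mul]
    exact congrArg (· * _) (CliffordAlgebra.contractRight_ι _ (coordForm n i) (X p))
  rw [schouten_apply, mfderiv_eq_fderiv_comp_extChartAt_symm]
  exact hrep

theorem mpullbackWithin_extChartAt_symm_eventuallyEq (p : M) (X : VF n M) :
    VectorField.mpullbackWithin 𝓘(ℝ, EuclideanSpace ℝ (Fin n)) (𝓡 n)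
      (extChartAt (𝓡 n) p).symm X (Set.range (𝓡 n)) =ᶠ[nhds (extChartAt (𝓡 n) p p)]
        chartRep p X := by
  have : IsManifold (𝓡 n) 1 M := .of_le (n := ∞) (by simp)
  filter_upwards [extChartAt_target_mem_nhds (I := 𝓡 n) p] with y hy
  have hsource : (extChartAt (𝓡 n) p).symm y ∈ (chartAt (EuclideanSpace ℝ (Fin n)) p).source := by
    rw [← extChartAt_source (𝓡 n)]
    exact (extChartAt (𝓡 n) p).map_target hy
  have hinverse := ContinuousLinearMap.inverse_eq
    (mfderivWithin_extChartAt_symm_comp_mfderiv_extChartAt hy)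
    (mfderiv_extChartAt_comp_mfderivWithin_extChartAt_symm hy)
  have hcoords := TangentBundle.continuousLinearMapAt_trivializationAt (I := 𝓡 n) hsource
  exact DFunLike.congr_fun (hinverse.trans hcoords.symm) (X ((extChartAt (𝓡 n) p).symm y))

theorem mlieBracket_eq_lieBracket_chartRep (X Y : VF n M) (p : M) :
    VectorField.mlieBracket (𝓡 n) X Y p = VectorField.lieBracket ℝ (chartRep p X) (chartRep p Y)
      (extChartAt (𝓡 n) p p) := by
  have : IsManifold (𝓡 n) 1 M := .of_le (n := ∞) (by simp)
  have hid (v : EuclideanSpace ℝ (Fin n)) : (mfderiv (𝓡 n) 𝓘(ℝ, EuclideanSpace ℝ (Fin n))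
      (extChartAt (𝓡 n) p) p).inverse v = v := by
    rw [mfderiv_extChartAt_self]
    exact DFunLike.congr_fun (ContinuousLinearMap.inverse_id (R := ℝ)
      (M := EuclideanSpace ℝ (Fin n))) v
  rw [← VectorField.mlieBracketWithin_univ, VectorField.mlieBracketWithin_apply]
  refine (hid _).trans ?_
  refine (Filter.EventuallyEq.lieBracketWithin_vectorField_eq_nhds (𝕜 := ℝ)
    (mpullbackWithin_extChartAt_symm_eventuallyEq p X)
    (mpullbackWithin_extChartAt_symm_eventuallyEq p Y)).trans ?_
  simp [VectorField.lieBracketWithin_univ]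

theorem schouten_ofVF_ofVF (X Y : VF n M) (p : M) :
    schouten (ofVF X : RoughField n M) (ofVF Y : RoughField n M) p =
      ExteriorAlgebra.ι ℝ (VectorField.mlieBracket (𝓡 n) X Y p) := by
  have hsum (U V : VF n M) := sum_coordForm_smul
    (fderiv ℝ (chartRep p V) (extChartAt (𝓡 n) p p)).toLinearMap
    (chartRep p U (extChartAt (𝓡 n) p p))
  have hlocal (U : VF n M) : localRep p (ofVF U : RoughField n M) p =
      ExteriorAlgebra.ι ℝ (chartRep p U (extChartAt (𝓡 n) p p)) := by
    rw [localRep_ofVF, chartRep, extChartAt_to_inv]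
  have hrep : schoutenRep p (ofVF X : RoughField n M) (ofVF Y : RoughField n M) =
      ExteriorAlgebra.ι ℝ (VectorField.lieBracket ℝ (chartRep p X) (chartRep p Y)
        (extChartAt (𝓡 n) p p)) := by
    refine Eq.trans ?_ (congrArg _ (congrArg₂ (· - ·) (hsum X Y) (hsum Y X)))
    rw [schoutenRep, map_sub, map_sum, map_sum, ← Finset.sum_sub_distrib]
    refine Finset.sum_congr rfl fun i _ => ?_
    rw [hlocal, hlocal, partialDeriv_ofVF, partialDeriv_ofVF, map_smul, map_smul, Algebra.smul_def,
      Algebra.smul_def, Algebra.commutes ((coordForm n i) (chartRep p Y _))]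
    exact congrArg₂ (fun a b => a * _ - _ * b) (CliffordAlgebra.contractRight_ι _ _ _)
      (CliffordAlgebra.contractLeft_ι _ _ _)
  rw [schouten_apply, mlieBracket_eq_lieBracket_chartRep]
  exact hrep

end Schouten

section MultivectorFields

variable {n : ℕ} {M : Type*} [TopologicalSpace M] [ChartedSpace (EuclideanSpace ℝ (Fin n)) M]
  [IsManifold (𝓡 n) ∞ M]

theorem isKVector_ofVF (X : VF n M) : IsKVector 1 (ofVF X) := fun p =>
  ι_mem_exteriorPower_one (X p)

theorem IsKVector.mul {k l : ℕ} {X Y : MV n M} (hX : IsKVector k X) (hY : IsKVector l Y) :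
    IsKVector (k + l) (X * Y) := fun p =>
  SetLike.mul_mem_graded (A := fun i : ℕ => ⋀[ℝ]^i (TangentSpace (𝓡 n) p)) (hX p) (hY p)

theorem ofFun_one : (ofFun 1 : MV n M) = 1 :=
  Subtype.ext (funext fun _ => map_one _)

theorem ofVF_injective : Function.Injective (ofVF : VF n M → MV n M) := fun _ _ h =>
  ContMDiffSection.ext fun p =>
    (ExteriorAlgebra.ι_inj ℝ _ _).1 (congrFun (congrArg Subtype.val h) p)

theorem ofVF_add (X Y : VF n M) : ofVF (X + Y) = ofVF X + ofVF Y :=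
  Subtype.ext (funext fun p => map_add _ (X p) (Y p))

theorem ofVF_eq_ofFun_mul {f : Fun n M} {X Y : VF n M} (h : ∀ p, Y p = f p • X p) :
    ofVF Y = ofFun f * ofVF X := by
  refine Subtype.ext (funext fun p => ?_)
  change ExteriorAlgebra.ι ℝ (Y p) = algebraMap ℝ _ (f p) * ExteriorAlgebra.ι ℝ (X p)
  rw [h, map_smul, Algebra.smul_def]

/-- The vector field given by the part of degree `1` of a multivector field. -/
def toVF (X : MV n M) : VF n M where
  toFun p := ExteriorAlgebra.ιInv (X.1 p)
  contMDiff_toFun p₀ := by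
    have hcoords (q : M) : tangentCoords p₀ q (ExteriorAlgebra.ιInv (X.1 q)) =
        ExteriorAlgebra.ιInv (localRep p₀ (X : RoughField n M) q) :=
      (LinearMap.congr_fun (ExteriorAlgebra.ιInv_comp_map (tangentCoords p₀ q)) (X.1 q)).symm
    have hsmooth := contMDiffOn_linearMap_localRep X p₀ ExteriorAlgebra.ιInv
    simp only [← hcoords] at hsmooth
    exact ((contMDiffOn_section_iff_tangentCoords p₀ _).2 hsmooth).contMDiffAt
      (chart_source_mem_nhds _ p₀)

theorem ofVF_toVF {X : MV n M} (hX : IsKVector 1 X) : ofVF (toVF X) = X := by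
  refine Subtype.ext (funext fun p => ?_)
  have hp := hX p
  rw [ExteriorAlgebra.exteriorPower, pow_one] at hp
  obtain ⟨v, hv⟩ := hp
  change ExteriorAlgebra.ι ℝ (ExteriorAlgebra.ιInv (X.1 p)) = X.1 p
  rw [← hv, ExteriorAlgebra.ι_leftInverse]

theorem exists_eq_ofFun {X : MV n M} (hX : IsKVector 0 X) : ∃ f : Fun n M, X = ofFun f := by
  have hscalar (p : M) : ∃ r : ℝ, algebraMap ℝ _ r = X.1 p := by
    have hp := hX p
    rw [ExteriorAlgebra.exteriorPower, pow_zero] at hp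
    exact Submodule.mem_one.1 hp
  choose f hf using hscalar
  have hcoords (p₀ q : M) :
      ExteriorAlgebra.algebraMapInv (localRep p₀ (X : RoughField n M) q) = f q := by
    rw [localRep, ← hf, AlgHom.commutes, AlgHom.commutes, Algebra.algebraMap_self_apply]
  have hsmooth : ContMDiff (𝓡 n) 𝓘(ℝ, ℝ) ∞ f := fun p₀ => by
    have h := contMDiffOn_linearMap_localRep X p₀ ExteriorAlgebra.algebraMapInv.toLinearMap
    simp only [AlgHom.toLinearMap_apply, hcoords] at h
    exact h.contMDiffAt (chart_source_mem_nhds _ p₀)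
  exact ⟨⟨f, hsmooth⟩, Subtype.ext (funext fun p => (hf p).symm)⟩

/-- The part of degree `k` of a multivector field. -/
def component (k : ℕ) (X : MV n M) : MV n M :=
  ⟨fun p => degreeProj ℝ _ k (X.1 p), fun p₀ S => by
    have hcoords (q : M) :
        localRep p₀ (fun p => degreeProj ℝ (TangentSpace (𝓡 n) p) k (X.1 p)) q =
          degreeProj ℝ _ k (localRep p₀ (X : RoughField n M) q) := map_degreeProj _ _ _
    simp only [hcoords]
    exact contMDiffOn_linearMap_localRep X p₀ ((extBasis n).coord S ∘ₗ degreeProj ℝ _ k)⟩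

theorem isKVector_component (k : ℕ) (X : MV n M) : IsKVector k (component k X) :=
  fun p => degreeProj_mem k (X.1 p)

theorem sum_component (X : MV n M) : ∑ k ∈ Finset.range (n + 1), component k X = X := by
  refine Subtype.ext (funext fun p => ?_)
  let b : Module.Basis (Fin n) ℝ (TangentSpace (𝓡 n) p) :=
    (EuclideanSpace.basisFun (Fin n) ℝ).toBasis
  have hp := sum_degreeProj b (X.1 p)
  rw [Fintype.card_fin] at hp
  rw [AddSubmonoidClass.coe_finsetSum, Finset.sum_apply]
  exact hp

theorem homogeneous_induction {P : MV n M → Prop}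
    (hom : ∀ (k : ℕ) (X : MV n M), IsKVector k X → P X) (add : ∀ X Y, P X → P Y → P (X + Y))
    (X : MV n M) : P X := by
  rw [← sum_component X]
  exact Finset.sum_induction _ P add (hom 0 0 fun p => Submodule.zero_mem _)
    fun k _ => hom k _ (isKVector_component k X)

theorem isKVector_prod_ofVF (L : List (VF n M)) : IsKVector L.length (L.map ofVF).prod := by
  induction L with
  | nil => exact fun p => SetLike.one_mem_graded fun i : ℕ => ⋀[ℝ]^i (TangentSpace (𝓡 n) p)
  | cons X L ih =>
    rw [List.map_cons, List.prod_cons, List.length_cons, add_comm]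
    exact (isKVector_ofVF X).mul ih

theorem exists_vectorField_apply_eq [T2Space M] (p : M) (v : TangentSpace (𝓡 n) p) :
    ∃ X : VF n M, X p = v := by
  obtain ⟨s, hs, hsmooth⟩ := FiberBundle.exists_contMDiffOn_extend (k := ∞) (𝓡 n)
    (EuclideanSpace ℝ (Fin n)) v
  obtain ⟨χ, -, hχ⟩ := (SmoothBumpFunction.nhds_basis_tsupport (I := 𝓡 n) p).mem_iff.1
    (interior_mem_nhds.2 hs)
  refine ⟨⟨_, ContMDiffOn.smul_section_of_tsupport χ.contMDiff.contMDiffOn isOpen_interior hχ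
    (hsmooth.mono interior_subset)⟩, ?_⟩
  change χ p • FiberBundle.extend (EuclideanSpace ℝ (Fin n)) v p = v
  rw [FiberBundle.extend_apply_self, χ.eq_one, one_smul]

theorem exists_prod_ofVF_apply_eq_ιMulti [T2Space M] (p : M) {k : ℕ}
    (v : Fin k → TangentSpace (𝓡 n) p) :
    ∃ L : List (VF n M), L.length = k ∧
      ((L.map ofVF).prod : MV n M).1 p = ExteriorAlgebra.ιMulti ℝ k v := by
  choose X hX using fun i => exists_vectorField_apply_eq p (v i)
  refine ⟨List.ofFn X, List.length_ofFn, ?_⟩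
  have hcoe : ((List.ofFn X).map ofVF).prod.1 =
      (List.ofFn fun i => ((ofVF (X i) : MV n M) : RoughField n M)).prod := by
    rw [← Subalgebra.coe_val, map_list_prod, List.map_map, List.map_ofFn]
    rfl
  rw [ExteriorAlgebra.ιMulti_apply, hcoe, Pi.list_prod_apply, List.map_ofFn]
  simp only [← hX]
  rfl

end MultivectorFields

section ProductRules

variable {n : ℕ} {M : Type*} [TopologicalSpace M] [ChartedSpace (EuclideanSpace ℝ (Fin n)) M]
  [IsManifold (𝓡 n) ∞ M]

namespace HigherConnection

theorem mul_nabla_comm_of_isKVector (C : HigherConnection n M) {k l m : ℕ} {X Y Z : MV n M}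
    (hX : IsKVector k X) (hY : IsKVector l Y) (hZ : IsKVector m Z) :
    Y * C.nabla X Z = sgn ((k + m - 1) * l) • (C.nabla X Z * Y) := by
  rcases Nat.eq_zero_or_pos (k + m) with hkm | hkm
  · obtain rfl : k = 0 := by omega
    obtain ⟨f, rfl⟩ := exists_eq_ofFun hX
    rw [C.fun_left, mul_zero, zero_mul, smul_zero]
  · have hsgn : sgn ((k + m - 1) * l) = (-1) ^ (l * (k + m - 1)) := by
      rw [← sgn_natCast, mul_comm l]
      push_cast [Nat.cast_sub hkm]
      rfl
    rw [hsgn]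
    exact Subtype.ext (funext fun p =>
      mul_comm_of_mem_exteriorPower (hY p) (C.degree k m X Z hX hZ hkm p))

/-- The failure of the product rule of a lower induced higher connection for `X ∈ A^k(M)`,
`Y ∈ A^l(M)` and any `Z`. -/
def lowerDefect (C : HigherConnection n M) (k l : ℕ) (X Y Z : MV n M) : MV n M :=
  C.nabla (X * Y) Z - (X * C.nabla Y Z + sgn ((k : ℤ) * (l : ℤ)) • (Y * C.nabla X Z))

/-- The failure of the product rule of an upper induced higher connection for `X ∈ A^k(M)`,
`Y ∈ A^l(M)` and any `Z`. -/
def upperDefect (C : HigherConnection n M) (k l : ℕ) (X Y Z : MV n M) : MV n M :=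
  C.nabla X (Y * Z) - (C.nabla X Y * Z + sgn (((k : ℤ) - 1) * (l : ℤ)) • (Y * C.nabla X Z))

theorem isLowerInduced_iff_lowerDefect_eq_zero (C : HigherConnection n M) :
    C.IsLowerInduced ↔ ∀ (k l m : ℕ) (X Y Z : MV n M), IsKVector k X → IsKVector l Y →
      IsKVector m Z → C.lowerDefect k l X Y Z = 0 := by
  refine ⟨fun h k l m X Y Z hX hY _ => sub_eq_zero.2 (h k l X Y Z hX hY),
    fun h k l X Y Z hX hY => ?_⟩
  induction Z using homogeneous_induction with
  | add Z Z' hZ hZ' =>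
    rw [C.add_right, hZ, hZ', C.add_right, C.add_right, mul_add, mul_add, smul_add]
    abel
  | hom m Z hZ => exact sub_eq_zero.1 (h k l m X Y Z hX hY hZ)

theorem isUpperInduced_iff_upperDefect_eq_zero (C : HigherConnection n M) :
    C.IsUpperInduced ↔ ∀ (k l m : ℕ) (X Y Z : MV n M), IsKVector k X → IsKVector l Y →
      IsKVector m Z → C.upperDefect k l X Y Z = 0 := by
  refine ⟨fun h k l m X Y Z hX hY _ => sub_eq_zero.2 (h k l X Y Z hX hY),
    fun h k l X Y Z hX hY => ?_⟩
  induction Z using homogeneous_induction with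
  | add Z Z' hZ hZ' =>
    rw [mul_add, C.add_right, hZ, hZ', C.add_right, mul_add, mul_add, smul_add]
    abel
  | hom m Z hZ => exact sub_eq_zero.1 (h k l m X Y Z hX hY hZ)

namespace IsTorsionFree

variable {C : HigherConnection n M} {k l m : ℕ} {X Y Z : MV n M}

theorem nabla_eq_schouten_add (hT : C.IsTorsionFree) (hX : IsKVector k X) (hY : IsKVector l Y) :
    (C.nabla X Y : RoughField n M) =
      schouten X Y + sgn ((k - 1) * (l - 1)) • (C.nabla Y X : RoughField n M) :=
  sub_eq_iff_eq_add.1 (sub_eq_zero.1 (hT k l X Y hX hY))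

theorem lowerDefect_eq_smul_upperDefect (hT : C.IsTorsionFree) (hX : IsKVector k X)
    (hY : IsKVector l Y) (hZ : IsKVector m Z) :
    C.lowerDefect k l X Y Z = sgn ((k + l - 1) * (m - 1)) • C.upperDefect m k Z X Y := by
  have sign_comm : sgn (k * l) * sgn ((k + m - 1) * l) = sgn (l * (m - 1)) := by
    rw [← sgn_add]
    exact sgn_eq_of_even_sub ⟨k * l, by ring⟩
  have sign_left : sgn ((k + l - 1) * (m - 1)) = sgn (l * (m - 1)) * sgn ((k - 1) * (m - 1)) := by
    rw [← sgn_add]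
    ring_nf
  have sign_right : sgn ((k + l - 1) * (m - 1)) * sgn ((m - 1) * k) = sgn ((l - 1) * (m - 1)) := by
    rw [← sgn_add]
    exact sgn_eq_of_even_sub ⟨(m - 1) * k, by ring⟩
  have hXZ := hT.nabla_eq_schouten_add hX hZ
  have hYZ := hT.nabla_eq_schouten_add hY hZ
  have hXY := hT.nabla_eq_schouten_add (hX.mul hY) hZ
  push_cast at hXY
  rw [lowerDefect, upperDefect, C.mul_nabla_comm_of_isKVector hX hY hZ, smul_smul, sign_comm,
    smul_sub, smul_add, smul_smul, sign_right]
  refine Subtype.ext ?_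
  push_cast
  simp only [hXY, schouten_mul_left X hY hZ, hXZ, hYZ, mul_add, add_mul, smul_add, smul_mul_assoc,
    smul_smul, ← sign_left, mul_smul_comm]
  abel

theorem isUpperInduced_iff_isLowerInduced (hT : C.IsTorsionFree) :
    C.IsUpperInduced ↔ C.IsLowerInduced := by
  rw [isUpperInduced_iff_upperDefect_eq_zero, isLowerInduced_iff_lowerDefect_eq_zero]
  refine ⟨fun h k l m X Y Z hX hY hZ => ?_, fun h m k l Z X Y hZ hX hY => ?_⟩
  · rw [hT.lowerDefect_eq_smul_upperDefect hX hY hZ, h m k l Z X Y hZ hX hY, smul_zero]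
  · have hlower := h k l m X Y Z hX hY hZ
    rw [hT.lowerDefect_eq_smul_upperDefect hX hY hZ] at hlower
    exact (smul_eq_zero.1 hlower).resolve_left (zpow_ne_zero _ (by norm_num))

end IsTorsionFree
end HigherConnection
end ProductRules

section Connections

variable {n : ℕ} {M : Type*} [TopologicalSpace M] [ChartedSpace (EuclideanSpace ℝ (Fin n)) M]
  [IsManifold (𝓡 n) ∞ M]

theorem AffineConnection.eq_of_nabla_eq {D D' : AffineConnection n M}
    (h : ∀ X Y, D.nabla X Y = D'.nabla X Y) : D = D' := by
  obtain ⟨nabla, _⟩ := D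
  obtain ⟨nabla', _⟩ := D'
  obtain rfl : nabla = nabla' := funext₂ h
  rfl

namespace HigherConnection

theorem nabla_add_left (C : HigherConnection n M) (X X' Y : MV n M) :
    C.nabla (X + X') Y = C.nabla X Y + C.nabla X' Y := by
  have h := C.linear_left 1 X X' Y
  rwa [ofFun_one, one_mul, one_mul] at h

theorem nabla_ofFun_mul_left (C : HigherConnection n M) (f : Fun n M) (X Y : MV n M) :
    C.nabla (ofFun f * X) Y = ofFun f * C.nabla X Y := by
  have hzero := C.nabla_add_left 0 0 Y
  rw [add_zero, left_eq_add] at hzero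
  have h := C.linear_left f X 0 Y
  rwa [add_zero, hzero, add_zero] at h

theorem ofVF_toVF_nabla (C : HigherConnection n M) (X Y : VF n M) :
    ofVF (toVF (C.nabla (ofVF X) (ofVF Y))) = C.nabla (ofVF X) (ofVF Y) :=
  ofVF_toVF (C.degree 1 1 _ _ (isKVector_ofVF X) (isKVector_ofVF Y) (by norm_num))

theorem ι_toVF_nabla (C : HigherConnection n M) (X Y : VF n M) (p : M) :
    ExteriorAlgebra.ι ℝ (toVF (C.nabla (ofVF X) (ofVF Y)) p) = (C.nabla (ofVF X) (ofVF Y)).1 p :=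
  congrFun (congrArg Subtype.val (C.ofVF_toVF_nabla X Y)) p

/-- The restriction of a higher connection to vector fields. -/
def toAffineConnection (C : HigherConnection n M) : AffineConnection n M where
  nabla X Y := toVF (C.nabla (ofVF X) (ofVF Y))
  add_left X X' Y := ofVF_injective <| by
    rw [ofVF_add (toVF _), C.ofVF_toVF_nabla, C.ofVF_toVF_nabla, C.ofVF_toVF_nabla, ofVF_add,
      C.nabla_add_left]
  smul_left f X fX Y h p := (ExteriorAlgebra.ι_inj ℝ _ _).1 <| by
    rw [map_smul, C.ι_toVF_nabla, C.ι_toVF_nabla, ofVF_eq_ofFun_mul h, C.nabla_ofFun_mul_left,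
      Algebra.smul_def]
    rfl
  add_right X Y Y' := ofVF_injective <| by
    rw [ofVF_add (toVF _), C.ofVF_toVF_nabla, C.ofVF_toVF_nabla, C.ofVF_toVF_nabla, ofVF_add,
      C.add_right]
  leibniz f X Y fY h p := (ExteriorAlgebra.ι_inj ℝ _ _).1 <| by
    have hleibniz := congrFun (C.leibniz 1 (ofVF X) f (ofVF Y) (isKVector_ofVF X)) p
    rw [Pi.add_apply, Pi.mul_apply, schouten_ofVF_ofFun] at hleibniz
    rw [map_add, map_smul, map_smul, C.ι_toVF_nabla, C.ι_toVF_nabla, ofVF_eq_ofFun_mul h,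
      Algebra.smul_def, Algebra.smul_def]
    exact hleibniz

theorem IsTorsionFree.toAffineConnection {C : HigherConnection n M} (hT : C.IsTorsionFree) :
    C.toAffineConnection.IsTorsionFree := by
  intro X Y p
  have h := congrFun (hT 1 1 (ofVF X) (ofVF Y) (isKVector_ofVF X) (isKVector_ofVF Y)) p
  have hsgn : sgn (((1 : ℕ) - 1) * ((1 : ℕ) - 1)) = 1 := by simp [sgn]
  rw [torsion, hsgn, one_smul, Pi.sub_apply, Pi.sub_apply, schouten_ofVF_ofVF] at h
  refine (ExteriorAlgebra.ι_eq_zero_iff (R := ℝ) _).1 ?_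
  rw [map_sub, map_sub]
  exact (congrArg₂ (· - · - _) (C.ι_toVF_nabla X Y p) (C.ι_toVF_nabla Y X p)).trans h

theorem isInducedBy_toAffineConnection {C : HigherConnection n M} (hL : C.IsLowerInduced)
    (hU : C.IsUpperInduced) : C.IsInducedBy C.toAffineConnection :=
  ⟨hL, hU, fun X Y => (C.ofVF_toVF_nabla X Y).symm⟩

theorem IsInducedBy.nabla_prod_ofVF_eq {C C' : HigherConnection n M} {D : AffineConnection n M}
    (hC : C.IsInducedBy D) (hC' : C'.IsInducedBy D) (L L' : List (VF n M)) :
    C.nabla (L.map ofVF).prod (L'.map ofVF).prod =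
      C'.nabla (L.map ofVF).prod (L'.map ofVF).prod := by
  obtain ⟨hL, hU, hD⟩ := hC
  obtain ⟨hL', hU', hD'⟩ := hC'
  have hvf (Y : VF n M) :
      C.nabla (L.map ofVF).prod (ofVF Y) = C'.nabla (L.map ofVF).prod (ofVF Y) := by
    induction L with
    | nil => rw [List.map_nil, List.prod_nil, ← ofFun_one, C.fun_left, C'.fun_left]
    | cons X L ih =>
      rw [List.map_cons, List.prod_cons, hL _ _ _ _ _ (isKVector_ofVF X) (isKVector_prod_ofVF L),
        hL' _ _ _ _ _ (isKVector_ofVF X) (isKVector_prod_ofVF L), ih, hD, hD']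
  induction L' with
  | nil =>
    refine Subtype.ext ?_
    rw [List.map_nil, List.prod_nil, ← ofFun_one, C.fun_right _ _ _ (isKVector_prod_ofVF L),
      C'.fun_right _ _ _ (isKVector_prod_ofVF L)]
  | cons Y L' ih =>
    rw [List.map_cons, List.prod_cons, hU _ _ _ _ _ (isKVector_prod_ofVF L) (isKVector_ofVF Y),
      hU' _ _ _ _ _ (isKVector_prod_ofVF L) (isKVector_ofVF Y), ih, hvf]

end HigherConnection

theorem TwistData.twist_eq_zero_of_prod_ofVF [T2Space M] {F : TwistData n M}
    (h : ∀ (L L' : List (VF n M)) (p : M), F.twist L.length L'.length p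
      ⟨(L.map ofVF).prod.1 p, isKVector_prod_ofVF L p⟩
      ⟨(L'.map ofVF).prod.1 p, isKVector_prod_ofVF L' p⟩ = 0) (k l : ℕ) (p : M) :
    F.twist k l p = 0 := by
  refine LinearMap.ext_on (exteriorPower.ιMulti_span ℝ k (TangentSpace (𝓡 n) p)) ?_
  rintro _ ⟨v, rfl⟩
  refine LinearMap.ext_on (exteriorPower.ιMulti_span ℝ l (TangentSpace (𝓡 n) p)) ?_
  rintro _ ⟨w, rfl⟩
  obtain ⟨L, rfl, hv⟩ := exists_prod_ofVF_apply_eq_ιMulti p v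
  obtain ⟨L', rfl, hw⟩ := exists_prod_ofVF_apply_eq_ιMulti p w
  have hv' : exteriorPower.ιMulti ℝ L.length v = ⟨_, isKVector_prod_ofVF L p⟩ :=
    Subtype.ext hv.symm
  have hw' : exteriorPower.ιMulti ℝ L'.length w = ⟨_, isKVector_prod_ofVF L' p⟩ :=
    Subtype.ext hw.symm
  rw [hv', hw']
  exact h L L' p

namespace HigherConnection

theorem IsInducedBy.eq_of_isAssociated {C : HigherConnection n M} {D D' : AffineConnection n M}
    {F : TwistData n M} (hC : C.IsInducedBy D) (h : C.IsAssociated D' F) : D' = D := by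
  obtain ⟨C', hC', hF⟩ := h
  refine AffineConnection.eq_of_nabla_eq fun X Y => ofVF_injective ?_
  rw [← hC'.2.2, ← hC.2.2]
  refine Subtype.ext (funext fun p => ?_)
  rw [hF 1 1 _ _ (isKVector_ofVF X) (isKVector_ofVF Y) p, F.one_one]
  exact (add_zero _).symm

theorem IsInducedBy.isAssociated_iff [T2Space M] {C : HigherConnection n M}
    {D D' : AffineConnection n M} {F : TwistData n M} (hC : C.IsInducedBy D) :
    C.IsAssociated D' F ↔ D' = D ∧ ∀ (k l : ℕ) (p : M), F.twist k l p = 0 := by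
  constructor
  · intro h
    obtain rfl := hC.eq_of_isAssociated h
    obtain ⟨C', hC', hF⟩ := h
    refine ⟨rfl, TwistData.twist_eq_zero_of_prod_ofVF fun L L' p => ?_⟩
    have hp := hF _ _ _ _ (isKVector_prod_ofVF L) (isKVector_prod_ofVF L') p
    rw [hC.nabla_prod_ofVF_eq hC' L L', left_eq_add] at hp
    exact ZeroMemClass.coe_eq_zero.1 hp
  · rintro ⟨rfl, hF⟩
    refine ⟨C, hC, fun k l X Y hX hY p => ?_⟩
    rw [hF k l p]
    exact (add_zero _).symm

end HigherConnection
end Connections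

end HigherConn

end

theorem mainTheorem5_general {n : ℕ} {M : Type*} [TopologicalSpace M] [T2Space M]
    [ChartedSpace (EuclideanSpace ℝ (Fin n)) M] [IsManifold (𝓡 n) ∞ M]
    (C : HigherConn.HigherConnection n M) (hC : C.IsUpperInduced ∨ C.IsLowerInduced)
    (hT : C.IsTorsionFree) :
    ∃ D : HigherConn.AffineConnection n M, D.IsTorsionFree ∧ C.IsInducedBy D ∧
      ∀ (D' : HigherConn.AffineConnection n M) (F : HigherConn.TwistData n M),
        C.IsAssociated D' F ↔ D' = D ∧ ∀ (k l : ℕ) (p : M), F.twist k l p = 0 := by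
  have hL : C.IsLowerInduced := hC.elim hT.isUpperInduced_iff_isLowerInduced.1 id
  have hU : C.IsUpperInduced := hT.isUpperInduced_iff_isLowerInduced.2 hL
  have hD : C.IsInducedBy C.toAffineConnection :=
    HigherConn.HigherConnection.isInducedBy_toAffineConnection hL hU
  exact ⟨C.toAffineConnection, hT.toAffineConnection, hD, fun _ _ => hD.isAssociated_iff⟩

theorem mainTheorem5 {n : ℕ} {M : Type*} [TopologicalSpace M] [T2Space M]
    [SecondCountableTopology M] [ChartedSpace (EuclideanSpace ℝ (Fin n)) M]
    [IsManifold (𝓡 n) ∞ M] (C : HigherConn.HigherConnection n M)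
    (hC : C.IsUpperInduced ∨ C.IsLowerInduced) (hT : C.IsTorsionFree) :
    ∃ D : HigherConn.AffineConnection n M, D.IsTorsionFree ∧ C.IsInducedBy D ∧
      ∀ (D' : HigherConn.AffineConnection n M) (F : HigherConn.TwistData n M),
        C.IsAssociated D' F ↔ D' = D ∧ ∀ (k l : ℕ) (p : M), F.twist k l p = 0 :=
  mainTheorem5_general C hC hT
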